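/- Let $m\le M$ be non-negative integers and let $X_1,X_2,\dots$ be i.i.d. random variables with values in $\mathbb N_0$ and probability mass function $p$ that vanishes outside $\{m,\dots,M\}$ and is non-increasing on it: $p(j+1)\le p(j)$ for $m\le j<M$. Let $\widehat p_n(j)=\frac1n\sum_{i=1}^n\mathbf 1_{\{X_i=j\}}$ be the empirical p.m.f. For a finite set $A$ of consecutive integers let the Grenander estimator on $A$ be $$\widehat p^{\mathcal M}_{n,A}=\operatorname*{arg\,min}_{q\ \text{non-increasing on }A}\Big(\sum_{j\in A}(\widehat p_n(j)-q(j))^2\Big)^{1/2},$$ extended by $0$ outside $A$. Let $\|\cdot\|_2$ be the Euclidean ($\ell_2$) norm. Then, both for $A=\{m,\dots,M\}$ and for the observed range $A=\{X_{(1)},X_{(1)}+1,\dots,X_{(n)}\}$, where $X_{(1)}=\min_{i\le n}X_i$ and $X_{(n)}=\max_{i\le n}X_i$, as $n\to\infty$, $$\sqrt n\,\big\|\widehat p^{\mathcal M}_{n,A}-\widehat p_n\big\|_2\ \overset{d}{\longrightarrow}\ \big\|G^{\mathcal M}-G\big\|_2 .$$ Here $G=(G_m,\dots,G_M)\sim\mathcal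 N(0,\Gamma)$ with $\Gamma_{r,s}=\mathbf 1_{\{r=s\}}p(r)-p(r)p(s)$ for $r,s\in\{m,\dots,M\}$, and $G^{\mathcal M}=(G^{\mathcal M}_m,\dots,G^{\mathcal M}_M)$ is defined blockwise: for every constancy region $\{i,\dots,j\}$ of $p$, i.e. $m\le i\le j\le M$, $p(i)=\dots=p(j)$, $p(i-1)>p(i)$ unless $i=m$, and $p(j)>p(j+1)$ unless $j=M$, $$(G^{\mathcal M}_i,\dots,G^{\mathcal M}_j)=\operatorname*{arg\,min}_{q\ \text{non-increasing on }\{i,\dots,j\}}\Big(\sum_{l=i}^j(G_l-q_l)^2\Big)^{1/2}.$$ -/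

import Mathlib

open MeasureTheory ProbabilityTheory Filter

noncomputable section

namespace GrenanderTest

/-- `w` is a least-squares projection of `v` on the sequences that are non-increasing on the finite
set `A` of integers, extended by `0` outside `A`. -/
structure IsMonoProj (A : Finset ℕ) (v w : ℕ → ℝ) : Prop where
  antitoneOn : AntitoneOn w (A : Set ℕ)
  eq_zero : ∀ j ∉ A, w j = 0
  le : ∀ q : ℕ → ℝ, AntitoneOn q (A : Set ℕ) →
    √(∑ j ∈ A, (v j - w j) ^ 2) ≤ √(∑ j ∈ A, (v j - q j) ^ 2)

/-- The monotone projection exists and is unique, so that the argmin below is well defined. -/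
theorem existsUnique_isMonoProj (A : Finset ℕ) (v : ℕ → ℝ) : ∃! w, IsMonoProj A v w := by
  classical
  set r : (ℕ → ℝ) → EuclideanSpace ℝ A := fun q => WithLp.toLp 2 fun j => q j with hr
  set e : EuclideanSpace ℝ A → ℕ → ℝ := fun x j => if h : j ∈ A then x ⟨j, h⟩ else 0 with he
  have hnorm : ∀ q : ℕ → ℝ, √(∑ j ∈ A, (v j - q j) ^ 2) = ‖r v - r q‖ := by
    intro q
    rw [EuclideanSpace.norm_eq, ← Finset.sum_coe_sort A]
    simp [hr]
  let K : Set (EuclideanSpace ℝ A) := {x | ∀ i j : A, i ≤ j → x j ≤ x i}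
  have hKc : IsClosed K := by
    simp only [K, Set.ofPred_forall]
    refine isClosed_iInter fun i => isClosed_iInter fun j => isClosed_iInter fun _ => ?_
    exact isClosed_le (by fun_prop) (by fun_prop)
  have hKconv : Convex ℝ K := by
    intro x hx y hy a b ha hb _ i j hij
    have h1 := mul_le_mul_of_nonneg_left (hx i j hij) ha
    have h2 := mul_le_mul_of_nonneg_left (hy i j hij) hb
    simpa using add_le_add h1 h2
  have hrK : ∀ q : ℕ → ℝ, AntitoneOn q (A : Set ℕ) → r q ∈ K := by
    intro q hq i j hij
    exact hq i.2 j.2 hij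
  have heK : ∀ x ∈ K, AntitoneOn (e x) (A : Set ℕ) := by
    intro x hx i hi j hj hij
    have hi' : i ∈ A := hi
    have hj' : j ∈ A := hj
    simp only [he, hi', hj', dif_pos]
    exact hx ⟨i, hi'⟩ ⟨j, hj'⟩ hij
  have hre : ∀ x, r (e x) = x := by
    intro x
    ext j
    simp [hr, he]
  obtain ⟨x, hxK, hx⟩ := exists_norm_eq_iInf_of_complete_convex
    (K := K) ⟨0, by intro i j _; simp⟩ hKc.isComplete hKconv (r v)
  have hbdd : BddBelow (Set.range fun w : K => ‖r v - w‖) :=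
    ⟨0, by rintro _ ⟨w, rfl⟩; exact norm_nonneg _⟩
  have huniq : ∀ y ∈ K, (∀ z ∈ K, ‖r v - y‖ ≤ ‖r v - z‖) → y = x := by
    intro y hy hmin
    have hy' : ‖r v - y‖ = ⨅ w : K, ‖r v - w‖ := by
      have : Nonempty K := ⟨⟨y, hy⟩⟩
      exact le_antisymm (le_ciInf fun w => hmin w w.2) (ciInf_le hbdd ⟨y, hy⟩)
    have h1 := (norm_eq_iInf_iff_real_inner_le_zero hKconv hxK).1 hx y hy
    have h2 := (norm_eq_iInf_iff_real_inner_le_zero hKconv hy).1 hy' x hxK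
    have h3 : inner ℝ (y - x) (y - x) ≤ 0 := by
      have : inner ℝ (y - x) (y - x) = inner ℝ (r v - x) (y - x) + inner ℝ (r v - y) (x - y) := by
        rw [← neg_sub y x, inner_neg_right, ← sub_eq_add_neg, ← inner_sub_left]
        congr 1
        abel
      linarith
    exact sub_eq_zero.1 (real_inner_self_nonpos.1 h3)
  refine ⟨e x, ⟨heK x hxK, fun j hj => by simp [he, hj], fun q hq => ?_⟩, ?_⟩
  · rw [hnorm, hnorm, hre, hx]
    exact ciInf_le hbdd ⟨r q, hrK q hq⟩
  · rintro w ⟨hw1, hw2, hw3⟩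
    have hwx : r w = x := by
      refine huniq _ (hrK w hw1) fun z hz => ?_
      have := hw3 (e z) (heK z hz)
      rwa [hnorm, hnorm, hre] at this
    funext j
    by_cases hj : j ∈ A
    · have : r w ⟨j, hj⟩ = x ⟨j, hj⟩ := by rw [hwx]
      simpa [hr, he, hj] using this
    · simp [he, hj, hw2 j hj]

/-- The monotone projection: the minimiser of `(∑ j ∈ A, (v j - q j) ^ 2) ^ (1 / 2)` over all `q`
that are non-increasing on `A`, extended by `0` outside `A`. -/
def monoProj (A : Finset ℕ) (v : ℕ → ℝ) : ℕ → ℝ :=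
  (existsUnique_isMonoProj A v).choose

theorem isMonoProj_monoProj (A : Finset ℕ) (v : ℕ → ℝ) : IsMonoProj A v (monoProj A v) :=
  (existsUnique_isMonoProj A v).choose_spec.1

/-- The Euclidean norm of a (finitely supported) real sequence on the non-negative integers. -/
def l2Norm (f : ℕ → ℝ) : ℝ := √(∑' j, f j ^ 2)

section Sample

variable {Ω : Type*}

/-- The empirical p.m.f. of the sample `X 0, …, X (n - 1)`. -/
def empPmf (X : ℕ → Ω → ℕ) (n : ℕ) (ω : Ω) (j : ℕ) : ℝ :=
  (n : ℝ)⁻¹ * ∑ i ∈ Finset.range n, if X i ω = j then 1 else 0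

/-- The integers between the smallest and the largest of `X 0, …, X (n - 1)`. -/
def sampleRange (X : ℕ → Ω → ℕ) (n : ℕ) (ω : Ω) : Finset ℕ :=
  Finset.Icc (sInf ((fun i => X i ω) '' Set.Iio n)) (sSup ((fun i => X i ω) '' Set.Iio n))

/-- The statistic `√n ‖p̂ₙᴹ - p̂ₙ‖₂`, where the Grenander estimator `p̂ₙᴹ` is the projection of the
empirical p.m.f. `p̂ₙ` on the sequences that are non-increasing on `A`. -/
def grenanderStat (X : ℕ → Ω → ℕ) (n : ℕ) (A : Finset ℕ) (ω : Ω) : ℝ :=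
  √(n : ℝ) * l2Norm (fun j => monoProj A (empPmf X n ω) j - empPmf X n ω j)

end Sample

/-- The covariance matrix `diag(p) - p pᵀ`, indexed by `{m, …, M}`. -/
def multinomialCov (p : ℕ → ℝ) (m M : ℕ) : Matrix (Finset.Icc m M) (Finset.Icc m M) ℝ :=
  Matrix.of fun r s => (if r = s then p r else 0) - p r * p s

/-- The constancy region of `l` for a `p` that is non-increasing on `{m, …, M}`; see
`constancyRegion_eq_Icc`. -/
def constancyRegion (p : ℕ → ℝ) (m M l : ℕ) : Finset ℕ := by
  classical exact (Finset.Icc m M).filter fun k => p k = p l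

/-- If `p` is non-increasing on `{m, …, M}`, a block `p (i - 1) > p i = ⋯ = p j > p (j + 1)`
(where the outer inequalities are only asked for inside `{m, …, M}`) is the constancy region of
each of its points. -/
theorem constancyRegion_eq_Icc {p : ℕ → ℝ} {m M i j l : ℕ}
    (hp : ∀ k ∈ Finset.Ico m M, p (k + 1) ≤ p k) (hi : m ≤ i) (hj : j ≤ M)
    (hc : ∀ k ∈ Finset.Icc i j, p k = p i)
    (hl : i = m ∨ p i < p (i - 1)) (hr : j = M ∨ p (j + 1) < p j)
    (hlm : l ∈ Finset.Icc i j) : constancyRegion p m M l = Finset.Icc i j := by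
  have anti : ∀ a b, m ≤ a → a ≤ b → b ≤ M → p b ≤ p a := by
    intro a b ha hab
    induction b, hab using Nat.le_induction with
    | base => intro _; exact le_rfl
    | succ b hab ih =>
      intro hb
      exact (hp b (Finset.mem_Ico.2 ⟨by omega, by omega⟩)).trans (ih (by omega))
  have hij := Finset.mem_Icc.1 hlm
  have hpl := hc l hlm
  have hpj := hc j (Finset.mem_Icc.2 ⟨by omega, le_rfl⟩)
  ext k
  simp only [constancyRegion, Finset.mem_filter, Finset.mem_Icc]
  constructor
  · rintro ⟨⟨h1, h2⟩, h3⟩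
    constructor
    · by_contra hk
      rcases hl with hl | hl
      · omega
      · have := anti k (i - 1) h1 (by omega) (by omega)
        linarith
    · by_contra hk
      rcases hr with hr | hr
      · omega
      · have := anti (j + 1) k (by omega) (by omega) h2
        linarith
  · rintro ⟨h1, h2⟩
    exact ⟨⟨by omega, by omega⟩, by rw [hc k (Finset.mem_Icc.2 ⟨h1, h2⟩), hpl]⟩

/-- The vector `gᴹ`, whose restriction to every constancy region `{i, …, j}` of `p` is the
projection of `(g i, …, g j)` on the vectors that are non-increasing on `{i, …, j}`. -/
def blockProj (p : ℕ → ℝ) (m M : ℕ) (g : EuclideanSpace ℝ (Finset.Icc m M)) :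
    EuclideanSpace ℝ (Finset.Icc m M) :=
  WithLp.toLp 2 fun l => monoProj (constancyRegion p m M l)
    (fun k => if h : k ∈ Finset.Icc m M then g ⟨k, h⟩ else 0) l

end GrenanderTest

end

/-! For large `n` the statistic is almost surely equal to a fixed continuous function of the
fluctuation `g = √n (p̂ₙ - p)`, so the limit follows from the central limit theorem and continuous
mapping. The equality is deterministic convex geometry. The monotone projection is characterised by
a variational inequality; it stays within the bounds of its data and commutes with `v ↦ c + s v` for
`s > 0`. If `v` is within `δ` of `p`, and distinct values of `p` are at least `2δ` apart, the
projections on the constancy regions cannot cross. Glued together they are therefore non-increasing,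
and adding their variational inequalities shows that they form the global projection
(`monoProj_eq_constancyRegion`). On each block `p` is constant, so equivariance turns the scaled
residual into `blockProj g - g` (`mul_l2Norm_monoProj_sub`). The strong law supplies the closeness.
It also makes `m` eventually observed, since `p m > 0`, and then projecting on the observed range
changes nothing: beyond the sample maximum the data vanish, and a nonnegative projection extended by
zero stays non-increasing. -/

namespace GrenanderTest

/-! ### Convex geometry of the monotone projection -/

/-- First-order optimality: moving from `w` to `w + t (q - w)` changes the squared distance by `-2ta
+ t²b`, which is negative for small `t > 0` if `a > 0`. -/
theorem IsMonoProj.sum_mul_nonpos {A : Finset ℕ} {v w q : ℕ → ℝ} (h : IsMonoProj A v w)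
    (hq : AntitoneOn q (A : Set ℕ)) : ∑ j ∈ A, (v j - w j) * (q j - w j) ≤ 0 := by
  by_contra! hpos
  set a := ∑ j ∈ A, (v j - w j) * (q j - w j) with ha
  set b := ∑ j ∈ A, (q j - w j) ^ 2 with hb
  have hb0 : 0 ≤ b := Finset.sum_nonneg fun _ _ => sq_nonneg _
  -- This choice lies in `(0, 1]` and satisfies `t * b ≤ a < 2 * a`, with no case split on `b = 0`.
  set t := a / (a + b) with ht
  have hab : 0 < a + b := by linarith
  have ht0 : 0 < t := div_pos hpos hab
  have ht1 : t ≤ 1 := (div_le_one hab).2 (by linarith)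
  have hmono : AntitoneOn (fun j => w j + t * (q j - w j)) (A : Set ℕ) := by
    intro i hi j hj hij
    have h1 := mul_le_mul_of_nonneg_left (hq hi hj hij) ht0.le
    have h2 := mul_le_mul_of_nonneg_left (h.antitoneOn hi hj hij) (sub_nonneg.2 ht1)
    simp only
    linarith
  have h1 := h.le _ hmono
  rw [Real.sqrt_le_sqrt_iff (Finset.sum_nonneg fun _ _ => sq_nonneg _)] at h1
  have h2 : ∑ j ∈ A, (v j - (w j + t * (q j - w j))) ^ 2
      = ∑ j ∈ A, (v j - w j) ^ 2 - 2 * t * a + t ^ 2 * b := by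
    rw [ha, hb, Finset.mul_sum, Finset.mul_sum, ← Finset.sum_sub_distrib, ← Finset.sum_add_distrib]
    exact Finset.sum_congr rfl fun _ _ => by ring
  have h3 : t * (2 * a - t * b) ≤ 0 := by linarith
  have h4 : t * b ≤ a := by
    have h5 : t * (a + b) = a := div_mul_cancel₀ _ hab.ne'
    nlinarith
  nlinarith [mul_pos ht0 (show 0 < 2 * a - t * b by linarith)]

theorem isMonoProj_of_sum_mul_nonpos {A : Finset ℕ} {v w : ℕ → ℝ}
    (hw : AntitoneOn w (A : Set ℕ)) (h0 : ∀ j ∉ A, w j = 0)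
    (h : ∀ q : ℕ → ℝ, AntitoneOn q (A : Set ℕ) → ∑ j ∈ A, (v j - w j) * (q j - w j) ≤ 0) :
    IsMonoProj A v w := by
  refine ⟨hw, h0, fun q hq => Real.sqrt_le_sqrt ?_⟩
  have h2 : ∑ j ∈ A, (v j - q j) ^ 2 = ∑ j ∈ A, (v j - w j) ^ 2
      - 2 * ∑ j ∈ A, (v j - w j) * (q j - w j) + ∑ j ∈ A, (q j - w j) ^ 2 := by
    rw [Finset.mul_sum, ← Finset.sum_sub_distrib, ← Finset.sum_add_distrib]
    exact Finset.sum_congr rfl fun _ _ => by ring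
  have h3 : 0 ≤ ∑ j ∈ A, (q j - w j) ^ 2 := Finset.sum_nonneg fun _ _ => sq_nonneg _
  linarith [h q hq]

theorem IsMonoProj.eq_monoProj {A : Finset ℕ} {v w : ℕ → ℝ} (h : IsMonoProj A v w) :
    w = monoProj A v :=
  (existsUnique_isMonoProj A v).unique h (isMonoProj_monoProj A v)

theorem monoProj_congr {A : Finset ℕ} {v v' : ℕ → ℝ} (h : ∀ j ∈ A, v j = v' j) :
    monoProj A v = monoProj A v' := by
  have hA := isMonoProj_monoProj A v
  refine IsMonoProj.eq_monoProj (isMonoProj_of_sum_mul_nonpos hA.antitoneOn hA.eq_zero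
    fun q hq => ?_)
  exact (Finset.sum_congr rfl fun j hj => by rw [h j hj]).trans_le (hA.sum_mul_nonpos hq)

/-- Test the variational inequality with `max w a`: every summand is nonnegative, so all of them
vanish, which rules out `w j < a`. -/
theorem le_monoProj {A : Finset ℕ} {v : ℕ → ℝ} {a : ℝ} (h : ∀ j ∈ A, a ≤ v j) :
    ∀ j ∈ A, a ≤ monoProj A v j := by
  have hA := isMonoProj_monoProj A v
  set w := monoProj A v
  have hq : AntitoneOn (fun j => max (w j) a) (A : Set ℕ) := fun i hi j hj hij =>
    max_le_max_right a (hA.antitoneOn hi hj hij)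
  have hnn : ∀ j ∈ A, 0 ≤ (v j - w j) * (max (w j) a - w j) := by
    intro j hj
    rcases le_total a (w j) with h1 | h1
    · simp [max_eq_left h1]
    · rw [max_eq_right h1]
      exact mul_nonneg (by linarith [h j hj]) (by linarith)
  intro j hj
  have h0 := (Finset.sum_eq_zero_iff_of_nonneg hnn).1
    (le_antisymm (hA.sum_mul_nonpos hq) (Finset.sum_nonneg hnn)) j hj
  by_contra! hlt
  rw [max_eq_right hlt.le] at h0
  exact (mul_pos (by linarith [h j hj] : 0 < v j - w j) (by linarith : 0 < a - w j)).ne' h0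

theorem monoProj_le {A : Finset ℕ} {v : ℕ → ℝ} {b : ℝ} (h : ∀ j ∈ A, v j ≤ b) :
    ∀ j ∈ A, monoProj A v j ≤ b := by
  have hA := isMonoProj_monoProj A v
  set w := monoProj A v
  have hq : AntitoneOn (fun j => min (w j) b) (A : Set ℕ) := fun i hi j hj hij =>
    min_le_min_right b (hA.antitoneOn hi hj hij)
  have hnn : ∀ j ∈ A, 0 ≤ (v j - w j) * (min (w j) b - w j) := by
    intro j hj
    rcases le_total (w j) b with h1 | h1
    · simp [min_eq_left h1]
    · rw [min_eq_right h1]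
      exact mul_nonneg_of_nonpos_of_nonpos (by linarith [h j hj]) (by linarith)
  intro j hj
  have h0 := (Finset.sum_eq_zero_iff_of_nonneg hnn).1
    (le_antisymm (hA.sum_mul_nonpos hq) (Finset.sum_nonneg hnn)) j hj
  by_contra! hlt
  rw [min_eq_right hlt.le] at h0
  exact (mul_pos_of_neg_of_neg (by linarith [h j hj] : v j - w j < 0)
    (by linarith : b - w j < 0)).ne' h0

/-- Projections are nonexpansive: add the variational inequalities of `w` and `w'`, each tested
against the other. -/
theorem sum_sq_monoProj_sub_le (A : Finset ℕ) (v v' : ℕ → ℝ) :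
    ∑ j ∈ A, (monoProj A v j - monoProj A v' j) ^ 2 ≤ ∑ j ∈ A, (v j - v' j) ^ 2 := by
  have h := isMonoProj_monoProj A v
  have h' := isMonoProj_monoProj A v'
  set w := monoProj A v
  set w' := monoProj A v'
  have h1 := h.sum_mul_nonpos h'.antitoneOn
  have h2 := h'.sum_mul_nonpos h.antitoneOn
  have h3 : ∑ j ∈ A, (v j - v' j) ^ 2 = ∑ j ∈ A, (w j - w' j) ^ 2
      + ∑ j ∈ A, ((v j - v' j) - (w j - w' j)) ^ 2
      - 2 * ∑ j ∈ A, (v j - w j) * (w' j - w j) - 2 * ∑ j ∈ A, (v' j - w' j) * (w j - w' j) := by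
    simp only [Finset.mul_sum, ← Finset.sum_sub_distrib, ← Finset.sum_add_distrib]
    exact Finset.sum_congr rfl fun _ _ => by ring
  have h4 : 0 ≤ ∑ j ∈ A, ((v j - v' j) - (w j - w' j)) ^ 2 :=
    Finset.sum_nonneg fun _ _ => sq_nonneg _
  linarith

/-- Being non-increasing is preserved by `q ↦ (q - c) / s`. The identity is restricted to `A`
because of the extension by zero. -/
theorem monoProj_const_add_mul {A : Finset ℕ} {v : ℕ → ℝ} (c : ℝ) {s : ℝ} (hs : 0 < s) {l : ℕ}
    (hl : l ∈ A) : monoProj A (fun j => c + s * v j) l = c + s * monoProj A v l := by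
  classical
  have hA := isMonoProj_monoProj A v
  set w := monoProj A v with hw
  have key : IsMonoProj A (fun j => c + s * v j) (fun j => if j ∈ A then c + s * w j else 0) := by
    refine isMonoProj_of_sum_mul_nonpos ?_ (fun j hj => by simp [hj]) fun q hq => ?_
    · intro i hi j hj hij
      have hi' : i ∈ A := hi
      have hj' : j ∈ A := hj
      simp only [hi', hj', if_true]
      linarith [mul_le_mul_of_nonneg_left (hA.antitoneOn hi hj hij) hs.le]
    · have hq' : AntitoneOn (fun j => (q j - c) / s) (A : Set ℕ) := fun i hi j hj hij =>
        div_le_div_of_nonneg_right (sub_le_sub_right (hq hi hj hij) c) hs.le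
      have h1 := mul_nonpos_of_nonneg_of_nonpos (sq_nonneg s) (hA.sum_mul_nonpos hq')
      rw [Finset.mul_sum] at h1
      refine le_of_eq_of_le (Finset.sum_congr rfl fun j hj => ?_) h1
      simp only [hj, if_true]
      field_simp
      ring
  simpa [hl] using (congrFun key.eq_monoProj l).symm

/-! ### Localisation to the constancy regions -/

theorem antitoneOn_Icc_of_succ_le {p : ℕ → ℝ} {m M : ℕ}
    (hp : ∀ k ∈ Finset.Ico m M, p (k + 1) ≤ p k) :
    AntitoneOn p (Finset.Icc m M : Set ℕ) := by
  intro a ha b hb hab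
  simp only [Finset.coe_Icc, Set.mem_Icc] at ha hb
  induction b, hab using Nat.le_induction with
  | base => exact le_rfl
  | succ b hab ih =>
    exact (hp b (Finset.mem_Ico.2 ⟨by omega, by omega⟩)).trans (ih (by omega))

theorem mem_constancyRegion {p : ℕ → ℝ} {m M l k : ℕ} :
    k ∈ constancyRegion p m M l ↔ k ∈ Finset.Icc m M ∧ p k = p l := by
  simp [constancyRegion]

theorem constancyRegion_congr {p : ℕ → ℝ} {m M k l : ℕ} (h : p k = p l) :
    constancyRegion p m M k = constancyRegion p m M l := by
  ext; simp [mem_constancyRegion, h]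

/-- Near a non-increasing `p`, the projection on `{m, …, M}` is computed blockwise. -/
theorem monoProj_eq_constancyRegion {p v : ℕ → ℝ} {m M : ℕ} {δ : ℝ}
    (hp : AntitoneOn p (Finset.Icc m M : Set ℕ))
    (hgap : ∀ k ∈ Finset.Icc m M, ∀ l ∈ Finset.Icc m M, p l < p k → p l + 2 * δ ≤ p k)
    (hv : ∀ k ∈ Finset.Icc m M, |v k - p k| ≤ δ) {l : ℕ} (hl : l ∈ Finset.Icc m M) :
    monoProj (Finset.Icc m M) v l = monoProj (constancyRegion p m M l) v l := by
  classical
  have hself : ∀ k ∈ Finset.Icc m M, k ∈ constancyRegion p m M k := fun k hk =>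
    mem_constancyRegion.2 ⟨hk, rfl⟩
  have hlow : ∀ k ∈ Finset.Icc m M, p k - δ ≤ monoProj (constancyRegion p m M k) v k :=
    fun k hk => le_monoProj (fun j hj => by
      obtain ⟨h1, h2⟩ := mem_constancyRegion.1 hj
      linarith [(abs_le.1 (hv j h1)).1]) k (hself k hk)
  have hupp : ∀ k ∈ Finset.Icc m M, monoProj (constancyRegion p m M k) v k ≤ p k + δ :=
    fun k hk => monoProj_le (fun j hj => by
      obtain ⟨h1, h2⟩ := mem_constancyRegion.1 hj
      linarith [(abs_le.1 (hv j h1)).2]) k (hself k hk)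
  have key : IsMonoProj (Finset.Icc m M) v (fun k => if k ∈ Finset.Icc m M then
      monoProj (constancyRegion p m M k) v k else 0) := by
    refine isMonoProj_of_sum_mul_nonpos ?_ (fun j hj => if_neg hj) fun q hq => ?_
    · intro i hi j hj hij
      have hi' : i ∈ Finset.Icc m M := hi
      have hj' : j ∈ Finset.Icc m M := hj
      simp only [hi', hj', if_true]
      -- Within one region both values come from the same projection; across regions the gap `2 * δ`
      -- absorbs the two errors `δ`.
      rcases (hp hi hj hij).eq_or_lt with h | h
      · rw [← constancyRegion_congr h]
        exact (isMonoProj_monoProj _ v).antitoneOn (mem_constancyRegion.2 ⟨hi', h.symm⟩)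
          (hself j hj') hij |>.trans_eq' (by rw [constancyRegion_congr h]) |>.trans_eq
            (by rw [constancyRegion_congr h])
      · linarith [hlow i hi', hupp j hj', hgap i hi' j hj' h]
    -- Grouping the sum by the value of `p` leaves one variational inequality per constancy region.
    · rw [← Finset.sum_fiberwise_of_maps_to (g := p) (t := (Finset.Icc m M).image p)
        fun k hk => Finset.mem_image_of_mem p hk]
      refine Finset.sum_nonpos fun c hc => ?_
      obtain ⟨k, hk, rfl⟩ := Finset.mem_image.1 hc
      have h1 := (isMonoProj_monoProj (constancyRegion p m M k) v).sum_mul_nonpos (q := q)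
        (hq.mono fun j hj => (mem_constancyRegion.1 hj).1)
      have h2 : (Finset.Icc m M).filter (fun j => p j = p k) = constancyRegion p m M k := by
        ext j; simp [mem_constancyRegion]
      rw [h2]
      refine le_of_eq_of_le (Finset.sum_congr rfl fun j hj => ?_) h1
      obtain ⟨h3, h4⟩ := mem_constancyRegion.1 hj
      simp only [h3, if_true, constancyRegion_congr h4]
  simpa only [hl, if_true] using (congrFun key.eq_monoProj l).symm

/-- The projection of nonnegative data is nonnegative, so its extension by zero stays
non-increasing. On the added points its residual is zero, so enlarging the range cannot help a
competitor. -/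
theorem monoProj_Icc_eq_of_eq_zero {v : ℕ → ℝ} {m b M : ℕ} (hbM : b ≤ M) (hv : ∀ j, 0 ≤ v j)
    (h0 : ∀ j, b < j → v j = 0) :
    monoProj (Finset.Icc m b) v = monoProj (Finset.Icc m M) v := by
  have hA := isMonoProj_monoProj (Finset.Icc m b) v
  have hnn := le_monoProj (A := Finset.Icc m b) (fun j _ => hv j)
  set w := monoProj (Finset.Icc m b) v
  have hsub : Finset.Icc m b ⊆ Finset.Icc m M := Finset.Icc_subset_Icc_right hbM
  refine IsMonoProj.eq_monoProj ⟨?_, fun j hj => hA.eq_zero j fun h => hj (hsub h), fun q hq => ?_⟩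
  · intro i hi j hj hij
    simp only [Finset.coe_Icc, Set.mem_Icc] at hi hj
    by_cases hjb : j ≤ b
    · exact hA.antitoneOn (by simp; omega) (by simp; omega) hij
    · rw [hA.eq_zero j (by simp; omega)]
      by_cases hib : i ≤ b
      · exact hnn i (by simp; omega)
      · rw [hA.eq_zero i (by simp; omega)]
  · have h1 : ∑ j ∈ Finset.Icc m M, (v j - w j) ^ 2 = ∑ j ∈ Finset.Icc m b, (v j - w j) ^ 2 := by
      refine (Finset.sum_subset hsub fun j hj hj' => ?_).symm
      simp only [Finset.mem_Icc] at hj hj'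
      rw [hA.eq_zero j (by simp; omega), h0 j (by omega)]
      simp
    rw [h1]
    exact (hA.le q (hq.mono (by exact_mod_cast hsub))).trans (Real.sqrt_le_sqrt
      (Finset.sum_le_sum_of_subset_of_nonneg hsub fun _ _ _ => sq_nonneg _))

/-- By nonexpansiveness, a coordinate moves by at most the Euclidean distance of the inputs over its
block. -/
theorem continuous_blockProj (p : ℕ → ℝ) (m M : ℕ) : Continuous (blockProj p m M) := by
  unfold blockProj
  refine (PiLp.continuous_toLp 2 _).comp (continuous_pi fun l => ?_)
  have hl : (l : ℕ) ∈ constancyRegion p m M l := mem_constancyRegion.2 ⟨l.2, rfl⟩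
  refine continuous_iff_continuousAt.2 fun g => ?_
  rw [ContinuousAt, tendsto_iff_dist_tendsto_zero]
  refine squeeze_zero (fun _ => dist_nonneg) (fun g' => ?_) (g := fun g' => √(∑ j ∈
    constancyRegion p m M l, ((if h : j ∈ Finset.Icc m M then g' ⟨j, h⟩ else 0) -
      (if h : j ∈ Finset.Icc m M then g ⟨j, h⟩ else 0)) ^ 2)) ?_
  · refine Real.le_sqrt_of_sq_le ((le_of_eq ?_).trans ((Finset.single_le_sum
      (fun _ _ => sq_nonneg _) hl).trans (sum_sq_monoProj_sub_le _ _ _)))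
    rw [Real.dist_eq, sq_abs]
  · have hc : Continuous fun g' : EuclideanSpace ℝ (Finset.Icc m M) => √(∑ j ∈
        constancyRegion p m M l, ((if h : j ∈ Finset.Icc m M then g' ⟨j, h⟩ else 0) -
        (if h : j ∈ Finset.Icc m M then g ⟨j, h⟩ else 0)) ^ 2) := by
      refine Real.continuous_sqrt.comp (continuous_finsetSum _ fun j _ => ?_)
      refine Continuous.pow (Continuous.sub ?_ continuous_const) 2
      split_ifs <;> fun_prop
    simpa using hc.tendsto g

theorem l2Norm_eq_sqrt_sum {f : ℕ → ℝ} {A : Finset ℕ} (h : ∀ j ∉ A, f j = 0) :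
    l2Norm f = √(∑ j ∈ A, f j ^ 2) := by
  rw [l2Norm, tsum_eq_sum fun j hj => by simp [h j hj]]

/-- If `v` vanishes outside `{m, …, M}` and is uniformly close to `p`, then the residual of its
projection is, up to scaling, the residual of the blockwise projection of the fluctuation. -/
theorem mul_l2Norm_monoProj_sub {p v : ℕ → ℝ} {m M : ℕ} {δ s : ℝ} (hs : 0 < s)
    (hp : AntitoneOn p (Finset.Icc m M : Set ℕ))
    (hgap : ∀ k ∈ Finset.Icc m M, ∀ l ∈ Finset.Icc m M, p l < p k → p l + 2 * δ ≤ p k)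
    (hv : ∀ k ∈ Finset.Icc m M, |v k - p k| ≤ δ) (hv0 : ∀ j ∉ Finset.Icc m M, v j = 0)
    (g : EuclideanSpace ℝ (Finset.Icc m M)) (hg : ∀ l, g l = s * (v l - p l)) :
    s * l2Norm (fun j => monoProj (Finset.Icc m M) v j - v j) = ‖blockProj p m M g - g‖ := by
  rw [l2Norm_eq_sqrt_sum (A := Finset.Icc m M) fun j hj => by
    rw [(isMonoProj_monoProj _ v).eq_zero j hj, hv0 j hj, sub_zero], EuclideanSpace.norm_eq,
    ← Finset.sum_coe_sort (Finset.Icc m M), ← Real.sqrt_sq hs.le, ← Real.sqrt_mul (sq_nonneg s),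
    Finset.mul_sum]
  congr 1
  refine Finset.sum_congr rfl fun l _ => ?_
  rw [← mul_pow, Real.norm_eq_abs, sq_abs]
  congr 1
  have hl : (l : ℕ) ∈ constancyRegion p m M l := mem_constancyRegion.2 ⟨l.2, rfl⟩
  -- On the region of `l`, `p` is the constant `p l`, so `v` is an affine image of `g` there.
  have h1 : monoProj (constancyRegion p m M l) v = monoProj (constancyRegion p m M l)
      (fun k => p l + s⁻¹ * (if h : k ∈ Finset.Icc m M then g ⟨k, h⟩ else 0)) := by
    refine monoProj_congr fun k hk => ?_
    obtain ⟨h2, h3⟩ := mem_constancyRegion.1 hk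
    rw [dif_pos h2, hg, ← h3]
    field_simp
    ring
  rw [monoProj_eq_constancyRegion hp hgap hv l.2, h1, monoProj_const_add_mul _ (inv_pos.2 hs) hl]
  simp only [blockProj, PiLp.sub_apply, hg l]
  field_simp
  ring

/-- The distinct values of `p` on a finite set are uniformly separated. -/
theorem exists_pos_forall_add_le (A : Finset ℕ) (p : ℕ → ℝ) :
    ∃ δ > 0, ∀ k ∈ A, ∀ l ∈ A, p l < p k → p l + 2 * δ ≤ p k := by
  classical
  set S := (A ×ˢ A).filter fun x => p x.2 < p x.1
  rcases S.eq_empty_or_nonempty with hS | hS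
  -- No two values differ, so any `δ` works; otherwise half the smallest gap does.
  · refine ⟨1, one_pos, fun k hk l hl hkl => ?_⟩
    have : (k, l) ∈ S := Finset.mem_filter.2 ⟨Finset.mk_mem_product hk hl, hkl⟩
    simp [hS] at this
  · obtain ⟨x, hx, hmin⟩ := S.exists_min_image (fun x => p x.1 - p x.2) hS
    refine ⟨(p x.1 - p x.2) / 2, by linarith [(Finset.mem_filter.1 hx).2],
      fun k hk l hl hkl => ?_⟩
    linarith [hmin (k, l) (Finset.mem_filter.2 ⟨Finset.mk_mem_product hk hl, hkl⟩)]

end GrenanderTest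

namespace GrenanderTest

open scoped RealInnerProductSpace Topology

/-! ### Multivariate central limit theorem -/

/-- The Cramér–Wold device: the characteristic function in `E` is read off from one-dimensional
projections. -/
theorem charFun_map_eq_charFun_map_inner {Ω E : Type*} [MeasurableSpace Ω] {P : Measure Ω}
    [NormedAddCommGroup E] [InnerProductSpace ℝ E] [MeasurableSpace E] [BorelSpace E]
    {Z : Ω → E} (hZ : AEMeasurable Z P) (t : E) :
    charFun (P.map Z) t = charFun (P.map fun ω => ⟪t, Z ω⟫) 1 := by
  have h : (fun ω => ⟪t, Z ω⟫) = (innerSL ℝ t) ∘ Z := rfl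
  rw [h, ← AEMeasurable.map_map_of_aemeasurable (innerSL ℝ t).measurable.aemeasurable hZ,
    ← charFunDual_eq_charFun_map_one, charFun_eq_charFunDual_toDualMap]
  rfl

section CentralLimit

variable {Ω Ω' E : Type*} [MeasurableSpace Ω] [MeasurableSpace Ω'] {P : Measure Ω}
  [IsProbabilityMeasure P] {P' : Measure Ω'} [IsProbabilityMeasure P'] [NormedAddCommGroup E]
  [InnerProductSpace ℝ E] [FiniteDimensional ℝ E] [MeasurableSpace E] [BorelSpace E]

/-- The central limit theorem in a Euclidean space. -/
theorem tendstoInDistribution_inv_sqrt_smul_sum_sub {Y : ℕ → Ω → E} {G : Ω' → E}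
    (hG : AEMeasurable G P')
    (hlaw : ∀ t : E, HasLaw (fun ω => ⟪t, G ω⟫)
      (gaussianReal 0 Var[fun ω => ⟪t, Y 0 ω⟫; P].toNNReal) P')
    (hY : MemLp (Y 0) 2 P) (hindep : iIndepFun Y P)
    (hident : ∀ i, IdentDistrib (Y i) (Y 0) P P) :
    TendstoInDistribution
      (fun (n : ℕ) ω => (√n)⁻¹ • (∑ k ∈ Finset.range n, Y k ω - (n : ℝ) • ∫ ω, Y 0 ω ∂P))
      atTop G (fun _ => P) P' := by
  have hmeas : ∀ n : ℕ, AEMeasurable (fun ω => (√n)⁻¹ •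
      (∑ k ∈ Finset.range n, Y k ω - (n : ℝ) • ∫ ω, Y 0 ω ∂P)) P := fun n =>
    ((Finset.aemeasurable_fun_sum _ fun k _ => (hident k).aemeasurable_fst).sub_const _).const_smul _
  refine ⟨hmeas, hG, ProbabilityMeasure.tendsto_iff_tendsto_charFun.2 fun t => ?_⟩
  have hmt : Measurable fun y : E => ⟪t, y⟫ := (innerSL ℝ t).measurable
  -- The scalar central limit theorem along the direction `t`, used only through its characteristic
  -- function at `1`.
  have h1 := tendstoInDistribution_inv_sqrt_mul_sum_sub (X := fun k ω => ⟪t, Y k ω⟫) (hlaw t)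
    (hY.const_inner t) (hindep.comp (fun _ y => ⟪t, y⟫) fun _ => hmt)
    fun i => (hident i).comp hmt
  have h2 := ProbabilityMeasure.tendsto_iff_tendsto_charFun.1 h1.tendsto 1
  simp only [ProbabilityMeasure.coe_mk] at h2 ⊢
  rw [charFun_map_eq_charFun_map_inner hG]
  refine h2.congr fun n => ?_
  rw [charFun_map_eq_charFun_map_inner (hmeas n)]
  congr 3
  funext ω
  rw [inner_smul_right, inner_sub_right, inner_sum, inner_smul_right,
    integral_inner (hY.integrable one_le_two)]

end CentralLimit

section Gaussian

variable {ι Ω : Type*} [Fintype ι] [DecidableEq ι] [MeasurableSpace Ω] {P : Measure Ω}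

/-- A linear image of a Gaussian is Gaussian, hence determined by its mean and variance; `hS` makes
`S` the actual covariance. -/
theorem hasLaw_inner_of_multivariateGaussian {S : Matrix ι ι ℝ} (hS : S.PosSemidef)
    {G : Ω → EuclideanSpace ℝ ι} (hG : HasLaw G (multivariateGaussian 0 S) P)
    (t : EuclideanSpace ℝ ι) :
    HasLaw (fun ω => ⟪t, G ω⟫) (gaussianReal 0 (t ⬝ᵥ S.mulVec t).toNNReal) P := by
  refine ⟨(innerSL ℝ t).measurable.comp_aemeasurable hG.aemeasurable, ?_⟩
  have h : (fun ω => ⟪t, G ω⟫) = (innerSL ℝ t) ∘ G := rfl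
  rw [h, ← AEMeasurable.map_map_of_aemeasurable (innerSL ℝ t).measurable.aemeasurable
    hG.aemeasurable, hG.map_eq, IsGaussian.map_eq_gaussianReal,
    ContinuousLinearMap.integral_comp_id_comm IsGaussian.integrable_id,
    integral_id_multivariateGaussian, map_zero, ← covarianceBilin_multivariateGaussian (μ := 0) hS,
    covarianceBilin_self IsGaussian.memLp_two_id]
  rfl

end Gaussian

/-! ### Moments, almost sure behaviour and measurability for the sample -/

section Sample

variable {Ω : Type*} [MeasurableSpace Ω]

/-- The vector of the indicators of `x = j` for `j ∈ {m, …, M}`. -/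
noncomputable def indicatorVec (m M x : ℕ) : EuclideanSpace ℝ (Finset.Icc m M) :=
  WithLp.toLp 2 fun j => if x = j then 1 else 0

@[simp]
theorem indicatorVec_apply (m M x : ℕ) (j : Finset.Icc m M) :
    indicatorVec m M x j = if x = j then 1 else 0 := rfl

theorem integral_ite_eq {P : Measure Ω} {X : Ω → ℕ} (hX : Measurable X) (j : ℕ) :
    ∫ ω, (if X ω = j then 1 else 0 : ℝ) ∂P = P.real {ω | X ω = j} := by
  have h : (fun ω => (if X ω = j then 1 else 0 : ℝ)) = {ω | X ω = j}.indicator 1 := by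
    ext ω; simp [Set.indicator_apply]
  have hs : MeasurableSet {ω | X ω = j} := hX (measurableSet_singleton j)
  rw [h, integral_indicator_one hs]

theorem memLp_comp_nat_of_bound {P : Measure Ω} [IsFiniteMeasure P] {E : Type*}
    [NormedAddCommGroup E] {X : Ω → ℕ} (hX : Measurable X) (f : ℕ → E) {C : ℝ}
    (hf : ∀ x, ‖f x‖ ≤ C) (q : ENNReal) : MemLp (fun ω => f (X ω)) q P :=
  MemLp.of_bound ((StronglyMeasurable.of_discrete (f := f)).comp_measurable hX).aestronglyMeasurable
    C (ae_of_all _ fun _ => hf _)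

theorem norm_indicatorVec_le (m M x : ℕ) : ‖indicatorVec m M x‖ ≤ √(Finset.Icc m M).card := by
  rw [EuclideanSpace.norm_eq]
  refine Real.sqrt_le_sqrt ?_
  calc ∑ j, ‖indicatorVec m M x j‖ ^ 2 ≤ ∑ _j : Finset.Icc m M, (1 : ℝ) :=
        Finset.sum_le_sum fun j _ => by rw [indicatorVec_apply]; split_ifs <;> simp
    _ = _ := by simp

variable {P : Measure Ω} [IsProbabilityMeasure P] {p : ℕ → ℝ} {m M : ℕ}

theorem integral_indicatorVec {X : Ω → ℕ} (hX : Measurable X)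
    (hlaw : ∀ j, P.real {ω | X ω = j} = p j) (j : Finset.Icc m M) :
    (∫ ω, indicatorVec m M (X ω) ∂P) j = p j := by
  rw [eval_integral_piLp fun i => ?_]
  · simp only [indicatorVec_apply]
    rw [integral_ite_eq hX, hlaw]
  · exact (memLp_comp_nat_of_bound hX (fun x => indicatorVec m M x i) (C := 1)
      (fun x => by rw [indicatorVec_apply]; split_ifs <;> simp) 1).integrable le_rfl

theorem variance_inner_indicatorVec {X : Ω → ℕ} (hX : Measurable X)
    (hlaw : ∀ j, P.real {ω | X ω = j} = p j) (t : EuclideanSpace ℝ (Finset.Icc m M)) :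
    Var[fun ω => ⟪t, indicatorVec m M (X ω)⟫; P] = t ⬝ᵥ (multinomialCov p m M).mulVec t := by
  have hint : ∀ (a : Finset.Icc m M → ℝ),
      ∫ ω, ∑ j, a j * (if X ω = j then 1 else 0 : ℝ) ∂P = ∑ j, a j * p j := by
    intro a
    rw [integral_finsetSum]
    · exact Finset.sum_congr rfl fun j _ => by
        rw [integral_const_mul, integral_ite_eq hX, hlaw]
    · exact fun j _ => ((memLp_comp_nat_of_bound hX (fun x => if x = j then (1 : ℝ) else 0)
        (C := 1) (fun x => by split_ifs <;> simp) 1).integrable le_rfl).const_mul _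
  have hin : ∀ x, ⟪t, indicatorVec m M x⟫ = ∑ j, t j * (if x = j then 1 else 0 : ℝ) := by
    intro x
    rw [PiLp.inner_apply]
    exact Finset.sum_congr rfl fun j _ => by simp
  -- At most one indicator is nonzero, so squaring produces no cross terms.
  have hsq : ∀ x, ⟪t, indicatorVec m M x⟫ ^ 2 = ∑ j, t j ^ 2 * (if x = j then 1 else 0 : ℝ) := by
    intro x
    rw [hin]
    by_cases hx : x ∈ Finset.Icc m M
    · have h1 : ∀ a : Finset.Icc m M → ℝ, ∑ j, a j * (if x = j then 1 else 0 : ℝ) = a ⟨x, hx⟩ := by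
        intro a
        rw [Finset.sum_eq_single ⟨x, hx⟩ (fun j _ hj => ?_) (by simp)]
        · simp
        · rw [if_neg fun h => hj (Subtype.ext h.symm), mul_zero]
      rw [h1, h1]
    · have h1 : ∀ a : Finset.Icc m M → ℝ, ∑ j, a j * (if x = j then 1 else 0 : ℝ) = 0 :=
        fun a => Finset.sum_eq_zero fun j _ => by
          rw [if_neg (ne_of_mem_of_not_mem j.2 hx).symm, mul_zero]
      rw [h1, h1]; simp
  rw [variance_eq_sub ((memLp_comp_nat_of_bound hX (indicatorVec m M)
    (norm_indicatorVec_le m M) 2).const_inner t)]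
  simp only [Pi.pow_apply, hsq]
  simp only [hin, hint]
  simp only [dotProduct, Matrix.mulVec, multinomialCov, Matrix.of_apply, sub_mul, ite_mul, zero_mul,
    Finset.sum_sub_distrib, Finset.sum_ite_eq, Finset.mem_univ, if_true, mul_sub]
  congr 1
  · exact Finset.sum_congr rfl fun j _ => by ring
  · rw [sq, Finset.sum_mul]
    exact Finset.sum_congr rfl fun j _ => by
      rw [Finset.mul_sum, Finset.mul_sum]
      exact Finset.sum_congr rfl fun k _ => by ring

/-- Its quadratic form is a variance. -/
theorem posSemidef_multinomialCov {X : Ω → ℕ} (hX : Measurable X)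
    (hlaw : ∀ j, P.real {ω | X ω = j} = p j) : (multinomialCov p m M).PosSemidef := by
  refine Matrix.PosSemidef.of_dotProduct_mulVec_nonneg ?_ fun t => ?_
  · ext i j
    by_cases h : i = j
    · simp [multinomialCov, h]
    · simp [multinomialCov, h, Ne.symm h, mul_comm]
  · have := variance_nonneg (fun ω => ⟪WithLp.toLp 2 t, indicatorVec m M (X ω)⟫) P
    rw [variance_inner_indicatorVec hX hlaw] at this
    simpa using this

theorem identDistrib_of_real_eq {X Y : Ω → ℕ} (hX : Measurable X) (hY : Measurable Y)
    (h : ∀ j, P.real {ω | X ω = j} = P.real {ω | Y ω = j}) : IdentDistrib X Y P P := by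
  refine ⟨hX.aemeasurable, hY.aemeasurable, Measure.ext_of_singleton fun j => ?_⟩
  rw [Measure.map_apply hX (measurableSet_singleton j),
    Measure.map_apply hY (measurableSet_singleton j)]
  exact (measureReal_eq_measureReal_iff).1 (h j)

theorem ae_mem_Icc {X : Ω → ℕ} (hlaw : ∀ j, P.real {ω | X ω = j} = p j)
    (hsupp : ∀ j, j ∉ Finset.Icc m M → p j = 0) : ∀ᵐ ω ∂P, X ω ∈ Finset.Icc m M := by
  have h : ∀ᵐ ω ∂P, ∀ j, j ∉ Finset.Icc m M → X ω ≠ j := by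
    refine ae_all_iff.2 fun j => ?_
    by_cases hj : j ∈ Finset.Icc m M
    · simp [hj]
    · have h0 : P {ω | X ω = j} = 0 := by
        rw [← measureReal_eq_zero_iff, hlaw, hsupp j hj]
      refine (measure_eq_zero_iff_ae_notMem.1 h0).mono fun ω hω _ => hω
  filter_upwards [h] with ω hω
  by_contra hX
  exact hω _ hX rfl

/-- `p m` is the largest value of `p` on its range, so if it vanished there would be no mass at all.
-/
theorem pmf_left_pos {X : Ω → ℕ} (hlaw : ∀ j, P.real {ω | X ω = j} = p j)
    (hsupp : ∀ j, j ∉ Finset.Icc m M → p j = 0)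
    (hp : AntitoneOn p (Finset.Icc m M : Set ℕ)) : 0 < p m := by
  obtain ⟨ω, hω⟩ := (ae_mem_Icc hlaw hsupp).exists
  have hmM : m ≤ M := (Finset.mem_Icc.1 hω).1.trans (Finset.mem_Icc.1 hω).2
  by_contra! h0
  have hall : ∀ j, p j = 0 := by
    intro j
    by_cases hj : j ∈ Finset.Icc m M
    · refine le_antisymm ((hp (by simpa using hmM) hj (Finset.mem_Icc.1 hj).1).trans h0) ?_
      rw [← hlaw j]
      exact measureReal_nonneg
    · exact hsupp j hj
  -- The interval from `1` to `0` is empty, so `X` would almost surely take no value.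
  obtain ⟨ω, hω⟩ := (ae_mem_Icc (m := 1) (M := 0) hlaw fun j _ => hall j).exists
  simp at hω

theorem ae_tendsto_empPmf {X : ℕ → Ω → ℕ} (hX : ∀ i, Measurable (X i)) (hindep : iIndepFun X P)
    (hlaw : ∀ i j, P.real {ω | X i ω = j} = p j) (j : ℕ) :
    ∀ᵐ ω ∂P, Tendsto (fun n => empPmf X n ω j) atTop (𝓝 (p j)) := by
  have hf : Measurable fun x : ℕ => (if x = j then 1 else 0 : ℝ) := .of_discrete
  have h := strong_law_ae_real (μ := P) (fun i ω => (if X i ω = j then 1 else 0 : ℝ))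
    ((memLp_comp_nat_of_bound (hX 0) (fun x => if x = j then (1 : ℝ) else 0)
        (C := 1) (fun x => by split_ifs <;> simp) 1).integrable le_rfl)
    (fun i k hik => (hindep.indepFun hik).comp hf hf)
    (fun i => (identDistrib_of_real_eq (hX i) (hX 0) fun k => by rw [hlaw, hlaw]).comp hf)
  rw [integral_ite_eq (hX 0), hlaw] at h
  filter_upwards [h] with ω hω
  exact hω.congr fun n => by rw [empPmf, div_eq_inv_mul]

/-- `monoProj` is defined by choice, but a function of finitely many `ℕ`-valued observations has a
countable discrete domain, so it is measurable whatever its form. -/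
theorem measurable_of_eq_of_forall_lt {β : Type*} [MeasurableSpace β] {X : ℕ → Ω → ℕ}
    (hX : ∀ i, Measurable (X i)) {n : ℕ} (F : (ℕ → ℕ) → β)
    (hF : ∀ x y : ℕ → ℕ, (∀ i < n, x i = y i) → F x = F y) :
    Measurable fun ω => F fun i => X i ω := by
  have h : (fun ω => F fun i => X i ω) = (fun x : Fin n → ℕ => F fun i =>
      if h : i < n then x ⟨i, h⟩ else 0) ∘ fun ω i => X i ω := by
    funext ω
    exact hF _ _ fun i hi => by simp [hi]
  rw [h]
  exact (measurable_of_countable _).comp (measurable_pi_lambda _ fun i => hX i)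

theorem empPmf_congr {Ω₁ Ω₂ : Type*} {X : ℕ → Ω₁ → ℕ} {Y : ℕ → Ω₂ → ℕ} {n : ℕ} {x : Ω₁} {y : Ω₂}
    (h : ∀ i < n, X i x = Y i y) : empPmf X n x = empPmf Y n y := by
  funext j
  unfold empPmf
  congr 1
  exact Finset.sum_congr rfl fun i hi => by rw [h i (Finset.mem_range.1 hi)]

theorem sampleRange_congr {Ω₁ Ω₂ : Type*} {X : ℕ → Ω₁ → ℕ} {Y : ℕ → Ω₂ → ℕ} {n : ℕ} {x : Ω₁}
    {y : Ω₂} (h : ∀ i < n, X i x = Y i y) : sampleRange X n x = sampleRange Y n y := by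
  unfold sampleRange
  have himage : (fun i => X i x) '' Set.Iio n = (fun i => Y i y) '' Set.Iio n :=
    Set.image_congr fun i hi => h i hi
  rw [himage]

theorem measurable_grenanderStat {X : ℕ → Ω → ℕ} (hX : ∀ i, Measurable (X i)) (n : ℕ)
    (A : Finset ℕ) : Measurable (grenanderStat X n A) :=
  measurable_of_eq_of_forall_lt hX (grenanderStat (fun i (x : ℕ → ℕ) => x i) n A)
    fun x y h => by
      unfold grenanderStat
      rw [empPmf_congr (X := fun i (x : ℕ → ℕ) => x i) (Y := fun i (x : ℕ → ℕ) => x i) h]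

theorem measurable_grenanderStat_sampleRange {X : ℕ → Ω → ℕ} (hX : ∀ i, Measurable (X i)) (n : ℕ) :
    Measurable fun ω => grenanderStat X n (sampleRange X n ω) ω :=
  measurable_of_eq_of_forall_lt hX (fun x => grenanderStat (fun i (x : ℕ → ℕ) => x i) n
      (sampleRange (fun i (x : ℕ → ℕ) => x i) n x) x)
    fun x y h => by
      unfold grenanderStat
      rw [empPmf_congr (X := fun i (x : ℕ → ℕ) => x i) (Y := fun i (x : ℕ → ℕ) => x i) h,
        sampleRange_congr (X := fun i (x : ℕ → ℕ) => x i) (Y := fun i (x : ℕ → ℕ) => x i) h]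

/-! ### From the statistic to the fluctuation -/

theorem empPmf_nonneg {Ω : Type*} (X : ℕ → Ω → ℕ) (n : ℕ) (ω : Ω) (j : ℕ) : 0 ≤ empPmf X n ω j :=
  mul_nonneg (by positivity) (Finset.sum_nonneg fun i _ => by split_ifs <;> simp)

theorem empPmf_eq_zero {Ω : Type*} {X : ℕ → Ω → ℕ} {n : ℕ} {ω : Ω} {j : ℕ}
    (h : ∀ i < n, X i ω ≠ j) : empPmf X n ω j = 0 := by
  rw [empPmf, Finset.sum_eq_zero fun i hi => if_neg (h i (Finset.mem_range.1 hi)), mul_zero]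

/-- If `m` is observed, the projections on `{m, …, M}` and on the observed range agree. -/
theorem grenanderStat_sampleRange {Ω : Type*} {X : ℕ → Ω → ℕ} {n : ℕ} {ω : Ω}
    (hmem : ∀ i, X i ω ∈ Finset.Icc m M) (hm : 0 < empPmf X n ω m) :
    grenanderStat X n (sampleRange X n ω) ω = grenanderStat X n (Finset.Icc m M) ω := by
  obtain ⟨k, hkn, hk⟩ : ∃ k < n, X k ω = m := by
    by_contra! h
    exact hm.ne' (empPmf_eq_zero h)
  set S := (fun i => X i ω) '' Set.Iio n with hS
  have hmS : m ∈ S := ⟨k, hkn, hk⟩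
  have hle : ∀ x ∈ S, x ≤ M := by
    rintro _ ⟨i, _, rfl⟩
    exact (Finset.mem_Icc.1 (hmem i)).2
  have hinf : sInf S = m := by
    refine le_antisymm (Nat.sInf_le hmS) (le_csInf ⟨m, hmS⟩ ?_)
    rintro _ ⟨i, _, rfl⟩
    exact (Finset.mem_Icc.1 (hmem i)).1
  have hsup : sSup S ≤ M := csSup_le ⟨m, hmS⟩ hle
  unfold grenanderStat
  rw [sampleRange, ← hS, hinf, monoProj_Icc_eq_of_eq_zero hsup (empPmf_nonneg X n ω)]
  exact fun j hj => empPmf_eq_zero fun i hi h =>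
    hj.not_ge (le_csSup ⟨M, hle⟩ ⟨i, hi, h⟩)

/-- The rescaled fluctuation of the empirical p.m.f. on `{m, …, M}`. -/
noncomputable def fluctuation (P : Measure Ω) (X : ℕ → Ω → ℕ) (m M n : ℕ) (ω : Ω) :
    EuclideanSpace ℝ (Finset.Icc m M) :=
  (√n)⁻¹ • (∑ k ∈ Finset.range n, indicatorVec m M (X k ω) -
    (n : ℝ) • ∫ ω, indicatorVec m M (X 0 ω) ∂P)

theorem fluctuation_apply {X : ℕ → Ω → ℕ} (hX : ∀ i, Measurable (X i))
    (hlaw : ∀ i j, P.real {ω | X i ω = j} = p j) {n : ℕ} (hn : 0 < n) (ω : Ω)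
    (l : Finset.Icc m M) : fluctuation P X m M n ω l = √n * (empPmf X n ω l - p l) := by
  have hn' : (0 : ℝ) < n := by exact_mod_cast hn
  have h1 : √(n : ℝ) * √n = n := Real.mul_self_sqrt hn'.le
  have h2 : 0 < √(n : ℝ) := Real.sqrt_pos.2 hn'
  simp only [fluctuation, PiLp.smul_apply, PiLp.sub_apply, smul_eq_mul,
    integral_indicatorVec (hX 0) (hlaw 0), empPmf, WithLp.ofLp_sum, Finset.sum_apply,
    indicatorVec_apply]
  field_simp
  rw [sq, h1]

theorem tendstoInDistribution_fluctuation {Ω' : Type*} [MeasurableSpace Ω'] {P' : Measure Ω'}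
    [IsProbabilityMeasure P'] {X : ℕ → Ω → ℕ} (hX : ∀ i, Measurable (X i))
    (hindep : iIndepFun X P) (hlaw : ∀ i j, P.real {ω | X i ω = j} = p j)
    {G : Ω' → EuclideanSpace ℝ (Finset.Icc m M)}
    (hG : HasLaw G (multivariateGaussian 0 (multinomialCov p m M)) P') :
    TendstoInDistribution (fluctuation P X m M) atTop G (fun _ => P) P' := by
  have hf : Measurable (indicatorVec m M) := .of_discrete
  refine tendstoInDistribution_inv_sqrt_smul_sum_sub
    (Y := fun k ω => indicatorVec m M (X k ω)) hG.aemeasurable (fun t => ?_)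
    (memLp_comp_nat_of_bound (hX 0) _ (norm_indicatorVec_le m M) 2)
    (hindep.comp (fun _ => indicatorVec m M) fun _ => hf)
    (fun i => (identDistrib_of_real_eq (hX i) (hX 0) fun k => by rw [hlaw, hlaw]).comp hf)
  rw [variance_inner_indicatorVec (hX 0) (hlaw 0)]
  exact hasLaw_inner_of_multivariateGaussian (posSemidef_multinomialCov (hX 0) (hlaw 0)) hG t

/-- The strong law at the finitely many points of `{m, …, M}` brings the empirical p.m.f. within `δ`
of `p` and makes its mass at `m` positive; from then on the argument is deterministic. -/
theorem ae_eventually_grenanderStat_eq {X : ℕ → Ω → ℕ} (hX : ∀ i, Measurable (X i))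
    (hindep : iIndepFun X P) (hlaw : ∀ i j, P.real {ω | X i ω = j} = p j)
    (hsupp : ∀ j, j ∉ Finset.Icc m M → p j = 0)
    (hp : AntitoneOn p (Finset.Icc m M : Set ℕ)) :
    ∀ᵐ ω ∂P, ∀ᶠ n in atTop,
      grenanderStat X n (Finset.Icc m M) ω =
        ‖blockProj p m M (fluctuation P X m M n ω) - fluctuation P X m M n ω‖ ∧
      grenanderStat X n (sampleRange X n ω) ω =
        ‖blockProj p m M (fluctuation P X m M n ω) - fluctuation P X m M n ω‖ := by
  obtain ⟨δ, hδ, hgap⟩ := exists_pos_forall_add_le (Finset.Icc m M) p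
  have hpos := pmf_left_pos (hlaw 0) hsupp hp
  filter_upwards [ae_all_iff.2 fun j => ae_tendsto_empPmf hX hindep hlaw j,
    ae_all_iff.2 fun i => ae_mem_Icc (hlaw i) hsupp] with ω hlim hmem
  have hclose : ∀ᶠ n in atTop, ∀ k ∈ Finset.Icc m M, |empPmf X n ω k - p k| ≤ δ :=
    (Finset.eventually_all _).2 fun k _ => by
      filter_upwards [Metric.tendsto_nhds.1 (hlim k) δ hδ] with n hn
      exact hn.le
  filter_upwards [hclose, (hlim m).eventually_const_lt hpos, eventually_gt_atTop 0] with n hn hm hn0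
  have h1 : grenanderStat X n (Finset.Icc m M) ω =
      ‖blockProj p m M (fluctuation P X m M n ω) - fluctuation P X m M n ω‖ :=
    mul_l2Norm_monoProj_sub (Real.sqrt_pos.2 (by exact_mod_cast hn0)) hp hgap hn
      (fun j hj => empPmf_eq_zero fun i _ h => hj (h ▸ hmem i)) _
      (fluctuation_apply hX hlaw hn0 ω)
  exact ⟨h1, (grenanderStat_sampleRange hmem hm).trans h1⟩

end Sample

/-- Slutsky: the difference is almost surely eventually zero, hence tends to zero in measure. -/
theorem tendstoInDistribution_of_ae_eventually_eq {Ω Ω' : Type*} [MeasurableSpace Ω]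
    [MeasurableSpace Ω'] {P : Measure Ω} [IsProbabilityMeasure P] {P' : Measure Ω'}
    [IsProbabilityMeasure P'] {U V : ℕ → Ω → ℝ} {Z : Ω' → ℝ}
    (hU : TendstoInDistribution U atTop Z (fun _ => P) P') (hV : ∀ n, AEMeasurable (V n) P)
    (h : ∀ᵐ ω ∂P, ∀ᶠ n in atTop, V n ω = U n ω) :
    TendstoInDistribution V atTop Z (fun _ => P) P' := by
  refine tendstoInDistribution_of_tendstoInMeasure_sub V Z hU
    (tendstoInMeasure_of_tendsto_ae
      (fun n => ((hV n).sub (hU.forall_aemeasurable n)).aestronglyMeasurable) ?_) hV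
  filter_upwards [h] with ω hω
  refine tendsto_const_nhds.congr' ?_
  filter_upwards [hω] with n hn
  simp [hn]

end GrenanderTest

theorem mainTheorem3 {Ω Ω' : Type*} [MeasurableSpace Ω] [MeasurableSpace Ω']
    (P : Measure Ω) [IsProbabilityMeasure P] (P' : Measure Ω') [IsProbabilityMeasure P']
    (m M : ℕ) (p : ℕ → ℝ) (X : ℕ → Ω → ℕ)
    (hX : ∀ i, Measurable (X i)) (hindep : iIndepFun X P)
    (hlaw : ∀ i j, P.real {ω | X i ω = j} = p j)
    (hsupp : ∀ j, j ∉ Finset.Icc m M → p j = 0)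
    (hmono : ∀ j ∈ Finset.Ico m M, p (j + 1) ≤ p j)
    (G : Ω' → EuclideanSpace ℝ (Finset.Icc m M))
    (hG : HasLaw G (multivariateGaussian 0 (GrenanderTest.multinomialCov p m M)) P') :
    TendstoInDistribution (fun (n : ℕ) ω => GrenanderTest.grenanderStat X n (Finset.Icc m M) ω) atTop
        (fun ω' => ‖GrenanderTest.blockProj p m M (G ω') - G ω'‖) (fun _ => P) P' ∧
      TendstoInDistribution (fun (n : ℕ) ω => GrenanderTest.grenanderStat X n (GrenanderTest.sampleRange X n ω) ω) atTop
        (fun ω' => ‖GrenanderTest.blockProj p m M (G ω') - G ω'‖) (fun _ => P) P' := by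
  -- Continuous mapping for `g ↦ ‖blockProj p m M g - g‖`.
  have hlim := (GrenanderTest.tendstoInDistribution_fluctuation hX hindep hlaw hG).continuous_comp
    ((GrenanderTest.continuous_blockProj p m M).sub continuous_id).norm
  have hae := GrenanderTest.ae_eventually_grenanderStat_eq hX hindep hlaw hsupp
    (GrenanderTest.antitoneOn_Icc_of_succ_le hmono)
  exact ⟨GrenanderTest.tendstoInDistribution_of_ae_eventually_eq hlim
      (fun n => (GrenanderTest.measurable_grenanderStat hX n _).aemeasurable)
      (hae.mono fun ω h => h.mono fun n hn => hn.1),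
    GrenanderTest.tendstoInDistribution_of_ae_eventually_eq hlim
      (fun n => (GrenanderTest.measurable_grenanderStat_sampleRange hX n).aemeasurable)
      (hae.mono fun ω h => h.mono fun n hn => hn.2)⟩
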